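/- Let $(X,\mathcal B,\mu)$ be a standard Borel space with a nonzero $\sigma$-finite measure $\mu$ without atoms. For a measure space $(Y,\mathcal C,\nu)$ let $Y^*$ be the space of countable subsets of $Y$ with the $\sigma$-algebra generated by the sets $\{\omega : |\omega\cap B|=n\}$ ($B\in\mathcal C$, $n\ge 0$), and let $\nu^*$ be the law on $Y^*$ of the Poisson point process with intensity $\nu$: under $\nu^*$, the counts $|\omega\cap A_i|$ of pairwise disjoint sets $A_1,\dots,A_n\in\mathcal C$ are independent, and $|\omega\cap A|$ is Poisson distributed with expectation $\nu(A)$ for every $A\in\mathcal C$ (almost surely infinite if $\nu(A)=\infty$). An action $T$ of a group on $Y$ induces the action $T_*\omega=\{Ty : y\in\omega\}$ on $Y^*$. A Poisson matching is a map $\Psi:X^*\times X^*\to (X\times X)^*$, measurable with respect to the $\mu^*\times\mu^*$-completion, such that for all $B_1,B_2\in\mathcal B$ and $\mu^*\times\mu^*$-almost every $(\omega_1,\omega_2)$: (M1) $|\Psi(\omega_1,\omega_2)\cap(B_1\times B_2)|\le\min\{|\omega_1\cap B_1|,|\omega_2\cap B_2|\}$; (M2) $|\Psi(\omega_1,\omega_2)\cap(B_1\times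 X)|=|\omega_1\cap B_1|$; (M3) $|\Psi(\omega_1,\omega_2)\cap(X\times B_2)|=|\omega_2\cap B_2|$. Given an action $T$ of a group $G$ on $X$, the matching is $T$-equivariant if, for every $g\in G$, $\Psi(T_{g*}\omega_1,T_{g*}\omega_2)=(T_g\times T_g)_*\Psi(\omega_1,\omega_2)$ for $\mu^*\times\mu^*$-almost every $(\omega_1,\omega_2)$. Let $T$ be an action of a group $G$ on $X$ by measurable, $\mu$-preserving transformations, and let $S=T\times T_*$ be the diagonal action of $G$ on $(X\times X^*,\mu\times\mu^*)$. Suppose that the action $S\times S_*$ of $G$ on $(X\times X^*)\times(X\times X^*)^*$ is ergodic with respect to $(\mu\times\mu^*)\times(\mu\times\mu^*)^*$, that is, every measurable set $A$ for which $gA$ and $A$ agree up to a null set for each $g\in G$ is null or has null complement. Then there is no $T$-equivariant Poisson matching. -/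

import Mathlib

open MeasureTheory ProbabilityTheory
open scoped Nat

/-- The space `X^*` of countable subsets of `X`. -/
@[ext]
structure Config (X : Type*) where
  carrier : Set X
  countable : carrier.Countable

namespace Config

/-- The number of points `|ω ∩ B|` of `ω` in `B`, an element of `{0, 1, 2, …, ∞}`. -/
noncomputable def count {X : Type*} (ω : Config X) (B : Set X) : ℕ∞ :=
  (ω.carrier ∩ B).encard

/-- The σ-algebra on `X^*` generated by the sets `[|ω ∩ B| = n]`, `B` measurable, `n ≥ 0`. -/
instance instMeasurableSpace {X : Type*} [MeasurableSpace X] : MeasurableSpace (Config X) :=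
  MeasurableSpace.generateFrom
    {S | ∃ (B : Set X) (n : ℕ), MeasurableSet B ∧ S = {ω : Config X | ω.count B = n}}

/-- The suspended action `T_*`: a group element `g` sends `ω` to `{g • x : x ∈ ω}`. -/
instance instMulAction {G X : Type*} [Group G] [MulAction G X] : MulAction G (Config X) where
  smul g ω := ⟨(fun x => g • x) '' ω.carrier, ω.countable.image _⟩
  one_smul ω := by
    apply Config.ext
    change (fun x => (1 : G) • x) '' ω.carrier = ω.carrier
    simp
  mul_smul g h ω := by
    apply Config.ext
    change (fun x => (g * h) • x) '' ω.carrier =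
      (fun x => g • x) '' ((fun x => h • x) '' ω.carrier)
    rw [Set.image_image]
    simp only [mul_smul]

end Config

/-- `P` is the law `μ^*` of the Poisson point process on `X` with intensity `μ`: the numbers of
points in disjoint measurable sets `A₁, …, Aₙ` are independent, and the number of points in a
measurable set `A` is Poisson with expectation `μ A` (almost surely infinite if `μ A = ∞`). -/
structure IsPoissonProcess {X : Type*} [MeasurableSpace X] (μ : Measure X)
    (P : Measure (Config X)) : Prop where
  isProbabilityMeasure : IsProbabilityMeasure P
  measure_count_eq : ∀ A : Set X, MeasurableSet A → ∀ k : ℕ,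
    P {ω | ω.count A = k} =
      if μ A = ⊤ then 0
      else ENNReal.ofReal (Real.exp (-(μ A).toReal) * (μ A).toReal ^ k / k !)
  iIndepFun_count : ∀ (n : ℕ) (A : Fin n → Set X), (∀ i, MeasurableSet (A i)) →
    Pairwise (fun i j => Disjoint (A i) (A j)) →
    iIndepFun (fun i (ω : Config X) => ω.count (A i)) P

/-- A (deterministic) Poisson matching, where `P` is the law of the Poisson process on `X`:
a measurable map `Ψ : X^* × X^* → (X × X)^*` (measurability with respect to the completion is
enough) which, for almost every pair `(ω₁, ω₂)` of independent Poisson realizations, is a perfect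
matching of the points of `ω₁` with the points of `ω₂`. -/
structure IsPoissonMatching {X : Type*} [MeasurableSpace X] (P : Measure (Config X))
    (Ψ : Config X × Config X → Config (X × X)) : Prop where
  aemeasurable : AEMeasurable Ψ (P.prod P)
  count_prod_le : ∀ B₁ B₂ : Set X, MeasurableSet B₁ → MeasurableSet B₂ →
    ∀ᵐ ω₁ ∂P, ∀ᵐ ω₂ ∂P, (Ψ (ω₁, ω₂)).count (B₁ ×ˢ B₂) ≤ min (ω₁.count B₁) (ω₂.count B₂)
  count_fst : ∀ B₁ : Set X, MeasurableSet B₁ →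
    ∀ᵐ ω₁ ∂P, ∀ᵐ ω₂ ∂P, (Ψ (ω₁, ω₂)).count (B₁ ×ˢ Set.univ) = ω₁.count B₁
  count_snd : ∀ B₂ : Set X, MeasurableSet B₂ →
    ∀ᵐ ω₂ ∂P, ∀ᵐ ω₁ ∂P, (Ψ (ω₁, ω₂)).count (Set.univ ×ˢ B₂) = ω₂.count B₂

/-- `Ψ` is equivariant: for every `g`, `Ψ (T_* ω₁, T_* ω₂) = (T × T)_* Ψ (ω₁, ω₂)` for almost
every `(ω₁, ω₂)`, where `T` is the action of `g`. -/
def IsEquivariantMatching (G : Type*) {X : Type*} [Group G] [MulAction G X] [MeasurableSpace X]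
    (P : Measure (Config X)) (Ψ : Config X × Config X → Config (X × X)) : Prop :=
  ∀ g : G, ∀ᵐ ω ∂(P.prod P), Ψ (g • ω.1, g • ω.2) = g • Ψ ω

/-! Let M(C) be the expected number of matched pairs in C ⊆ X × X. By (M1) and independence M is at
most μ × μ on rectangles, hence everywhere (`matchingIntensity_le`), so M has a density f with
respect to μ × μ. Equivariance makes f invariant under the diagonal action. Ergodicity is used
through the factor X × X^*. For an invariant D ⊆ X × X, the event that ω has no point in the section
D_x is invariant in (x, ω), hence null or conull. Its conditional probability given x is
exp(-μ(D_x)), so almost all sections are null or almost all have infinite measure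
(`ae_section_eq_zero_or_top`). Take D = {f > c} with c > 0. Infinite sections would give M(B × X) =
∞, whereas (M2) gives M(B × X) = μ(B), finite for suitable B. So f = 0 almost everywhere and M = 0,
which contradicts M(B × X) = μ(B) > 0. -/

open Set Filter
open scoped ENNReal symmDiff

/-! ### Comparison of measures on a product; invariant densities. -/

section ProductMeasure

variable {α β : Type*} [MeasurableSpace α] [MeasurableSpace β]

/-- Measurable rectangles form a semiring of sets. -/
theorem isSetSemiring_measurable_rectangles :
    IsSetSemiring (image2 (· ×ˢ ·) {s : Set α | MeasurableSet s} {t : Set β | MeasurableSet t}) where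
  empty_mem := ⟨∅, .empty, ∅, .empty, by simp⟩
  inter_mem := by
    rintro _ ⟨s, hs, t, ht, rfl⟩ _ ⟨s', hs', t', ht', rfl⟩
    exact ⟨s ∩ s', hs.inter hs', t ∩ t', ht.inter ht', by simp [Set.prod_inter_prod]⟩
  sdiff_eq_sUnion' := by
    classical
    rintro _ ⟨s, hs, t, ht, rfl⟩ _ ⟨s', hs', t', ht', rfl⟩
    refine ⟨{(s \ s') ×ˢ t, (s ∩ s') ×ˢ (t \ t')}, ?_, ?_, ?_⟩
    · intro u hu
      simp only [Finset.coe_insert, Finset.coe_singleton, mem_insert_iff, mem_singleton_iff] at hu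
      rcases hu with rfl | rfl
      · exact ⟨_, hs.diff hs', _, ht, rfl⟩
      · exact ⟨_, hs.inter hs', _, ht.diff ht', rfl⟩
    · have h : Disjoint ((s \ s') ×ˢ t) ((s ∩ s') ×ˢ (t \ t')) := by
        rw [Set.disjoint_left]
        rintro ⟨x, y⟩ h₁ h₂
        exact h₁.1.2 h₂.1.2
      simp only [Finset.coe_insert, Finset.coe_singleton]
      intro u hu v hv huv
      simp only [mem_insert_iff, mem_singleton_iff] at hu hv
      rcases hu with rfl | rfl <;> rcases hv with rfl | rfl
      · exact absurd rfl huv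
      · exact h
      · exact h.symm
      · exact absurd rfl huv
    · ext ⟨x, y⟩
      simp only [Set.mem_sdiff, mem_prod, Finset.coe_insert, Finset.coe_singleton, sUnion_insert,
        sUnion_singleton, mem_union, mem_inter_iff]
      tauto

/-- Finite measures on a product are compared on measurable rectangles. -/
theorem measure_le_of_rectangles_of_finite {ρ ν : Measure (α × β)} [IsFiniteMeasure ρ]
    [IsFiniteMeasure ν]
    (h : ∀ s t, MeasurableSet s → MeasurableSet t → ρ (s ×ˢ t) ≤ ν (s ×ˢ t)) : ρ ≤ ν := by
  refine Measure.le_iff.2 fun s hs => ENNReal.le_of_forall_pos_le_add fun ε hε _ => ?_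
  have hε2 : (0 : ℝ≥0∞) < (ε : ℝ≥0∞) / 2 := by simpa using hε.ne'
  -- Inequalities do not pass to proper differences, so a π-λ argument is not available. Instead `s`
  -- is approximated by a finite disjoint union of rectangles; using `ρ + ν` controls the error for
  -- both measures at once.
  obtain ⟨t, htC, ht⟩ := exists_measure_symmDiff_lt_of_generateFrom_isSetSemiring (μ := ρ + ν)
    (isSetSemiring_measurable_rectangles (α := α) (β := β))
    ⟨{univ}, countable_singleton _, by
      rintro _ rfl; exact ⟨univ, .univ, univ, .univ, by simp⟩, by simp⟩
    generateFrom_prod.symm hs hε2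
  obtain ⟨p, hp⟩ := isSetSemiring_measurable_rectangles.mem_supClosure_iff.1 htC
  have hmeas : ∀ u ∈ p.parts, MeasurableSet u := by
    intro u hu
    obtain ⟨a, ha, b, hb, rfl⟩ := hp hu
    exact MeasurableSet.prod ha hb
  have ht_eq : t = ⋃ u ∈ p.parts, u := by
    have := p.sup_parts
    rw [Finset.sup_id_set_eq_sUnion, sUnion_eq_biUnion] at this
    exact this.symm
  have hsum : ∀ m : Measure (α × β), m t = ∑ u ∈ p.parts, m u := by
    intro m
    refine (congrArg m ht_eq).trans ?_
    exact measure_biUnion_finset (fun u hu v hv huv => p.disjoint hu hv huv) hmeas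
  have hle : ρ t ≤ ν t := by
    rw [hsum, hsum]
    refine Finset.sum_le_sum fun u hu => ?_
    obtain ⟨a, ha, b, hb, rfl⟩ := hp hu
    exact h a b ha hb
  have hρ : ρ s ≤ ρ t + ρ (t ∆ s) :=
    (measure_mono (fun x hx => by by_cases hxt : x ∈ t <;> simp [mem_symmDiff, hx, hxt])).trans
      (measure_union_le _ _)
  have hν : ν t ≤ ν s + ν (t ∆ s) :=
    (measure_mono (fun x hx => by by_cases hxs : x ∈ s <;> simp [mem_symmDiff, hx, hxs])).trans
      (measure_union_le _ _)
  have h1 : ρ (t ∆ s) + ν (t ∆ s) < (ε : ℝ≥0∞) / 2 := ht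
  calc ρ s ≤ ρ t + ρ (t ∆ s) := hρ
    _ ≤ (ν s + ν (t ∆ s)) + ρ (t ∆ s) := by gcongr; exact hle.trans hν
    _ = ν s + (ρ (t ∆ s) + ν (t ∆ s)) := by rw [add_assoc, add_comm (ν (t ∆ s))]
    _ ≤ ν s + ε := by gcongr; exact h1.le.trans ENNReal.half_le_self

/-- A measure on a product is bounded by a product of `σ`-finite measures as soon as it is so on
measurable rectangles. -/
theorem measure_le_prod_of_rectangles {ρ : Measure (α × β)} {μ : Measure α} {ν : Measure β}
    [SigmaFinite μ] [SigmaFinite ν]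
    (h : ∀ s t, MeasurableSet s → MeasurableSet t → ρ (s ×ˢ t) ≤ μ s * ν t) : ρ ≤ μ.prod ν := by
  let S : ℕ → Set (α × β) := fun n => spanningSets μ n ×ˢ spanningSets ν n
  have hSm : ∀ n, MeasurableSet (S n) := fun n =>
    (measurableSet_spanningSets μ n).prod (measurableSet_spanningSets ν n)
  have hfin : ∀ n, μ (spanningSets μ n) * ν (spanningSets ν n) < ∞ := fun n =>
    ENNReal.mul_lt_top (measure_spanningSets_lt_top μ n) (measure_spanningSets_lt_top ν n)
  have hS_mono : Monotone S := fun m n hmn =>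
    prod_mono (monotone_spanningSets μ hmn) (monotone_spanningSets ν hmn)
  have hS_univ : ⋃ n, S n = univ := by
    rw [iUnion_prod_of_monotone (monotone_spanningSets μ) (monotone_spanningSets ν)]
    simp [iUnion_spanningSets]
  have hloc : ∀ n, ρ.restrict (S n) ≤ (μ.prod ν).restrict (S n) := by
    intro n
    have : IsFiniteMeasure (ρ.restrict (S n)) :=
      ⟨by simpa using (h _ _ (measurableSet_spanningSets μ n)
        (measurableSet_spanningSets ν n)).trans_lt (hfin n)⟩
    have : IsFiniteMeasure ((μ.prod ν).restrict (S n)) := ⟨by simpa [S] using hfin n⟩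
    refine measure_le_of_rectangles_of_finite fun s t hs ht => ?_
    rw [Measure.restrict_apply (hs.prod ht), Measure.restrict_apply (hs.prod ht),
      Set.prod_inter_prod, Measure.prod_prod]
    exact h _ _ (hs.inter (measurableSet_spanningSets μ n))
      (ht.inter (measurableSet_spanningSets ν n))
  refine Measure.le_iff.2 fun s hs => ?_
  have hs_eq : s = ⋃ n, s ∩ S n := by rw [← inter_iUnion, hS_univ, inter_univ]
  have hs_mono : Monotone fun n => s ∩ S n := fun m n hmn => inter_subset_inter_right _ (hS_mono hmn)
  rw [hs_eq, hs_mono.measure_iUnion, hs_mono.measure_iUnion]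
  refine iSup_mono fun n => ?_
  rw [← Measure.restrict_apply hs, ← Measure.restrict_apply hs]
  exact hloc n s

/-- If `ρ ≪ ν` and both are invariant under a measurable automorphism, then so is the density. -/
theorem rnDeriv_comp_ae_eq_of_measurePreserving {γ : Type*} [MeasurableSpace γ]
    {ρ ν : Measure γ} [SigmaFinite ρ] [SigmaFinite ν] (hρν : ρ ≪ ν) (e : γ ≃ᵐ γ)
    (hρ : MeasurePreserving e ρ ρ) (hν : MeasurePreserving e ν ν) :
    (fun z => ρ.rnDeriv ν (e z)) =ᵐ[ν] ρ.rnDeriv ν := by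
  -- Uniqueness of the Lebesgue decomposition, with zero singular part: the composed density only
  -- has to integrate to `ρ` over every set.
  refine Measure.eq_rnDeriv (s := 0) ((Measure.measurable_rnDeriv ρ ν).comp e.measurable)
    (Measure.MutuallySingular.zero_left) ?_
  rw [zero_add]
  ext s hs
  have hs' : MeasurableSet (e.symm ⁻¹' s) := e.symm.measurable hs
  have hse : e ⁻¹' (e.symm ⁻¹' s) = s := by ext; simp
  rw [withDensity_apply _ hs, ← hse, hρ.measure_preimage hs'.nullMeasurableSet,
    hν.setLIntegral_comp_preimage hs' (Measure.measurable_rnDeriv ρ ν),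
    Measure.setLIntegral_rnDeriv hρν]

end ProductMeasure

/-! ### Counts and counting measures of configurations. -/

namespace Config

variable {X : Type*}

theorem carrier_smul {G : Type*} [Group G] [MulAction G X] (g : G) (ω : Config X) :
    (g • ω).carrier = (fun x => g • x) '' ω.carrier := rfl

theorem count_smul {G : Type*} [Group G] [MulAction G X] (g : G) (ω : Config X) (B : Set X) :
    (g • ω).count B = ω.count ((fun x => g • x) ⁻¹' B) := by
  rw [count, count, carrier_smul, ← image_inter_preimage,
    (MulAction.injective g).injOn.encard_image]

variable [MeasurableSpace X]

theorem measurable_count {B : Set X} (hB : MeasurableSet B) :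
    Measurable fun ω : Config X => ω.count B :=
  ENat.measurable_iff.2 fun n => MeasurableSpace.measurableSet_generateFrom ⟨B, n, hB, rfl⟩

theorem measurable_toENNReal_count {B : Set X} (hB : MeasurableSet B) :
    Measurable fun ω : Config X => (ω.count B : ℝ≥0∞) :=
  (measurable_from_top (f := fun n : ℕ∞ => (n : ℝ≥0∞))).comp (measurable_count hB)

instance instMeasurableConstSMul {G : Type*} [Group G] [MulAction G X] [MeasurableConstSMul G X] :
    MeasurableConstSMul G (Config X) where
  measurable_const_smul g := by
    refine measurable_generateFrom ?_
    rintro _ ⟨B, n, hB, rfl⟩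
    change MeasurableSet {ω : Config X | (g • ω).count B = n}
    simp only [count_smul]
    exact measurable_count (measurable_const_smul g hB) (measurableSet_singleton (n : ℕ∞))

/-- The counting measure of a configuration. -/
noncomputable def toMeasure (ω : Config X) : Measure X := Measure.count.restrict ω.carrier

theorem toMeasure_apply [MeasurableSingletonClass X] (ω : Config X) {B : Set X}
    (hB : MeasurableSet B) : ω.toMeasure B = (ω.count B : ℝ≥0∞) := by
  rw [toMeasure, Measure.restrict_apply hB,
    Measure.count_apply (hB.inter ω.countable.measurableSet), inter_comm, count]

theorem measurable_toMeasure [MeasurableSingletonClass X] :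
    Measurable (toMeasure : Config X → Measure X) :=
  Measure.measurable_of_measurable_coe _ fun B hB => by
    simpa only [toMeasure_apply _ hB] using measurable_toENNReal_count hB

/-- The counting measure of a configuration on `S`, set to zero when it is infinite. -/
noncomputable def finiteKernel [MeasurableSingletonClass X] (S : Set X) (hS : MeasurableSet S) :
    Kernel (Config X) X where
  toFun := by
    classical
    exact fun ω => if ω.count S = ⊤ then 0 else ω.toMeasure.restrict S
  measurable' := by
    classical
    refine Measurable.ite (measurable_count hS (measurableSet_singleton ⊤)) measurable_const ?_
    refine Measure.measurable_of_measurable_coe _ fun B hB => ?_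
    simp only [Measure.restrict_apply hB, toMeasure_apply _ (hB.inter hS)]
    exact measurable_toENNReal_count (hB.inter hS)

theorem finiteKernel_apply [MeasurableSingletonClass X] {S : Set X} (hS : MeasurableSet S)
    {ω : Config X} (hω : ω.count S ≠ ⊤) {B : Set X} (hB : MeasurableSet B) :
    finiteKernel S hS ω B = (ω.count (B ∩ S) : ℝ≥0∞) := by
  classical
  change (if ω.count S = ⊤ then (0 : Measure X) else ω.toMeasure.restrict S) B = _
  rw [if_neg hω, Measure.restrict_apply hB, toMeasure_apply _ (hB.inter hS)]

instance [MeasurableSingletonClass X] {S : Set X} (hS : MeasurableSet S) (ω : Config X) :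
    IsFiniteMeasure (finiteKernel S hS ω) := by
  classical
  change IsFiniteMeasure (if ω.count S = ⊤ then (0 : Measure X) else ω.toMeasure.restrict S)
  split_ifs with h
  · infer_instance
  · refine ⟨?_⟩
    rw [Measure.restrict_apply .univ, toMeasure_apply _ (MeasurableSet.univ.inter hS), univ_inter]
    simpa [lt_top_iff_ne_top] using h

end Config

/-! ### Void probabilities and mean counts of a Poisson process. -/

namespace IsPoissonProcess

variable {X : Type*} [MeasurableSpace X] {μ : Measure X} {P : Measure (Config X)}

theorem measure_count_eq_zero (hP : IsPoissonProcess μ P) {A : Set X} (hA : MeasurableSet A) :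
    P {ω | ω.count A = 0} = if μ A = ⊤ then 0 else ENNReal.ofReal (Real.exp (-(μ A).toReal)) := by
  simpa using hP.measure_count_eq A hA 0

/-- The void probability exp(-μ(A)) equals 1 only if μ(A) = 0, and, for the next lemma, equals 0
only if μ(A) = ∞. -/
theorem measure_eq_zero_of_ae_count (hP : IsPoissonProcess μ P) {A : Set X}
    (hA : MeasurableSet A) (h : ∀ᵐ ω ∂P, ω.count A = 0) : μ A = 0 := by
  have := hP.isProbabilityMeasure
  have h1 : P {ω | ω.count A = 0} = 1 := (prob_compl_eq_zero_iff
    (Config.measurable_count hA (measurableSet_singleton 0))).1 h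
  rw [hP.measure_count_eq_zero hA] at h1
  split_ifs at h1 with htop
  · simp at h1
  · have : Real.exp (-(μ A).toReal) = 1 := by simpa using h1
    simpa [ENNReal.toReal_eq_zero_iff, htop] using this

theorem measure_eq_top_of_ae_count_ne (hP : IsPoissonProcess μ P) {A : Set X}
    (hA : MeasurableSet A) (h : ∀ᵐ ω ∂P, ω.count A ≠ 0) : μ A = ⊤ := by
  have h1 : P {ω | ω.count A = 0} = 0 := by
    rw [← nonpos_iff_eq_zero, ← show P {ω | ¬ ω.count A ≠ 0} = 0 from h]
    exact measure_mono fun ω hω => by simpa using hω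
  rw [hP.measure_count_eq_zero hA] at h1
  by_contra htop
  rw [if_neg htop, ENNReal.ofReal_eq_zero] at h1
  exact absurd h1 (not_le.2 (Real.exp_pos _))

theorem ae_count_eq_zero (hP : IsPoissonProcess μ P) {A : Set X} (hA : MeasurableSet A)
    (h : μ A = 0) : ∀ᵐ ω ∂P, ω.count A = 0 := by
  have := hP.isProbabilityMeasure
  refine (prob_compl_eq_zero_iff (Config.measurable_count hA (measurableSet_singleton 0))).2 ?_
  change P {ω | ω.count A = 0} = 1
  simpa [h] using hP.measure_count_eq_zero hA

theorem ae_count_eq_top (hP : IsPoissonProcess μ P) {A : Set X} (hA : MeasurableSet A)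
    (h : μ A = ⊤) : ∀ᵐ ω ∂P, ω.count A = ⊤ := by
  have h0 : ∀ᵐ ω ∂P, ∀ k : ℕ, ω.count A ≠ (k : ℕ∞) := ae_all_iff.2 fun k => by
    simpa [ae_iff, h] using hP.measure_count_eq A hA k
  filter_upwards [h0] with ω hω
  by_contra hne
  exact hω _ (ENat.natCast_toNat hne).symm

/-- The Poisson weights sum to 1 and leave no mass for the value ∞. -/
theorem ae_count_ne_top (hP : IsPoissonProcess μ P) {A : Set X} (hA : MeasurableSet A)
    (h : μ A ≠ ⊤) : ∀ᵐ ω ∂P, ω.count A ≠ ⊤ := by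
  have := hP.isProbabilityMeasure
  have hm : ∀ n : ℕ∞, MeasurableSet {ω : Config X | ω.count A = n} := fun n =>
    Config.measurable_count hA (measurableSet_singleton n)
  have hdisj : Pairwise (Function.onFun Disjoint fun k : ℕ => {ω : Config X | ω.count A = k}) := by
    intro i j hij
    refine Set.disjoint_left.2 fun ω hi hj => hij ?_
    have h1 : (i : ℕ∞) = j := (show ω.count A = i from hi).symm.trans hj
    exact_mod_cast h1
  have hU : P (⋃ k : ℕ, {ω | ω.count A = k}) = 1 := by
    rw [measure_iUnion hdisj fun k => hm k]
    simp only [hP.measure_count_eq A hA, if_neg h]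
    have hs : HasSum (fun k : ℕ => Real.exp (-(μ A).toReal) * (μ A).toReal ^ k / k !) 1 :=
      hasSum_one_poissonMeasure (μ A).toNNReal
    rw [← ENNReal.ofReal_tsum_of_nonneg (fun k => by positivity) hs.summable]
    exact (congrArg _ hs.tsum_eq).trans ENNReal.ofReal_one
  have := (prob_compl_eq_zero_iff (.iUnion fun k : ℕ => hm k)).2 hU
  rw [compl_iUnion] at this
  rw [ae_iff, ← nonpos_iff_eq_zero, ← this]
  refine measure_mono fun ω hω => mem_iInter.2 fun k hk => ?_
  have h1 : ω.count A = ⊤ := by simpa using hω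
  exact ENat.natCast_ne_top k ((show ω.count A = k from hk).symm.trans h1)

/-- The intensity is the expected number of points. -/
theorem lintegral_count (hP : IsPoissonProcess μ P) {A : Set X} (hA : MeasurableSet A) :
    ∫⁻ ω, (ω.count A : ℝ≥0∞) ∂P = μ A := by
  have := hP.isProbabilityMeasure
  by_cases h : μ A = ⊤
  · rw [h, lintegral_congr_ae (g := fun _ => ⊤)
      ((hP.ae_count_eq_top hA h).mono fun ω hω => by simp [hω])]
    simp
  · have hm : Measurable fun ω : Config X => ω.count A := Config.measurable_count hA
    rw [← lintegral_map (f := fun n : ℕ∞ => (n : ℝ≥0∞)) measurable_from_top hm,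
      lintegral_countable']
    rw [tsum_eq_tsum_of_ne_zero_bij (g := fun k : ℕ => (k : ℝ≥0∞) * P {ω | ω.count A = k})
      (fun k => ((k : ℕ) : ℕ∞))]
    · simp only [hP.measure_count_eq A hA, if_neg h]
      set r := (μ A).toReal with hr
      have hr0 : 0 ≤ r := ENNReal.toReal_nonneg
      have hs : HasSum (fun k : ℕ => (k : ℝ) * (Real.exp (-r) * r ^ k / k !)) r := by
        -- The term at 0 vanishes, and after the shift each term is `r` times a Poisson weight.
        rw [← hasSum_nat_add_iff' 1]
        have h1 : HasSum (fun k : ℕ => Real.exp (-r) * r ^ k / k !) 1 :=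
          hasSum_one_poissonMeasure (μ A).toNNReal
        simp only [Finset.range_one, Finset.sum_singleton, Nat.cast_zero, zero_mul, sub_zero]
        refine (mul_one r ▸ h1.mul_left r).congr_fun fun k => ?_
        rw [Nat.factorial_succ]
        push_cast
        field_simp
        ring
      have : ∀ k : ℕ, (k : ℝ≥0∞) * ENNReal.ofReal (Real.exp (-r) * r ^ k / k !) =
          ENNReal.ofReal ((k : ℝ) * (Real.exp (-r) * r ^ k / k !)) := fun k => by
        rw [ENNReal.ofReal_mul (Nat.cast_nonneg k), ENNReal.ofReal_natCast]
      simp only [this]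
      rw [← ENNReal.ofReal_tsum_of_nonneg (fun k => by positivity) hs.summable, hs.tsum_eq,
        ENNReal.ofReal_toReal h]
    · intro a b hab
      exact Subtype.ext (Nat.cast_injective (R := ℕ∞) hab)
    · intro n hn
      induction n with
      | top =>
        exfalso
        refine hn ?_
        simp only [Measure.map_apply hm (measurableSet_singleton _)]
        have h0 : P {ω | ω.count A = ⊤} = 0 := by simpa [ae_iff] using hP.ae_count_ne_top hA h
        exact mul_eq_zero_of_right _ h0
      | coe k =>
        refine ⟨⟨k, fun hk => hn ?_⟩, rfl⟩
        simp only [Measure.map_apply hm (measurableSet_singleton _)]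
        exact hk
    · intro k
      rw [Measure.map_apply hm (measurableSet_singleton _)]
      rfl

end IsPoissonProcess

/-! ### Ergodicity and invariance of factors of a product. -/

instance Prod.instMeasurableConstSMul {G α β : Type*} [SMul G α] [SMul G β] [MeasurableSpace α]
    [MeasurableSpace β] [MeasurableConstSMul G α] [MeasurableConstSMul G β] :
    MeasurableConstSMul G (α × β) where
  measurable_const_smul g := (measurable_fst.const_smul g).prodMk (measurable_snd.const_smul g)

/-- The first factor of an ergodic product with a probability space is ergodic. -/
theorem ErgodicSMul.fst_of_prod {G α β : Type*} [Group G] [MulAction G α] [MulAction G β]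
    [MeasurableSpace α] [MeasurableSpace β] [MeasurableConstSMul G α] {m : Measure α} {Q : Measure β}
    [SFinite m] [IsProbabilityMeasure Q] (h : ErgodicSMul G (α × β) (m.prod Q)) :
    ErgodicSMul G α m where
  measure_preimage_smul g s hs := by
    have hfst : MeasurePreserving Prod.fst (m.prod Q) m := measurePreserving_fst
    rw [← hfst.measure_preimage hs.nullMeasurableSet,
      ← hfst.measure_preimage (measurable_const_smul g hs).nullMeasurableSet]
    exact h.measure_preimage_smul g (measurable_fst hs)
  aeconst_of_forall_preimage_smul_ae_eq {s} hs hinv := by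
    have hfst : MeasurePreserving Prod.fst (m.prod Q) m := measurePreserving_fst
    have := h.aeconst_of_forall_preimage_smul_ae_eq (measurable_fst hs)
      fun g => hfst.quasiMeasurePreserving.preimage_ae_eq (hinv g)
    rw [eventuallyConst_set] at this ⊢
    exact this.imp
      (fun h1 => (ae_map_iff hfst.measurable.aemeasurable hs).2 h1 |> fun h2 => hfst.map_eq ▸ h2)
      (fun h1 => (ae_map_iff hfst.measurable.aemeasurable hs.compl).2 h1 |>
        fun h2 => hfst.map_eq ▸ h2)

/-- If `m × P` is invariant, with `m` invariant and nonzero `σ`-finite, then so is `P`. -/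
theorem SMulInvariantMeasure.snd_of_prod {G α β : Type*} [Group G] [MulAction G α] [MulAction G β]
    [MeasurableSpace α] [MeasurableSpace β] [MeasurableConstSMul G α] [MeasurableConstSMul G β]
    {m : Measure α} {P : Measure β} [SigmaFinite m] [SFinite P] (hm : m ≠ 0)
    [SMulInvariantMeasure G α m] [SMulInvariantMeasure G (α × β) (m.prod P)] :
    SMulInvariantMeasure G β P where
  measure_preimage_smul g s hs := by
    -- A set of positive finite measure, so that its measure cancels in the product formula.
    obtain ⟨n, hn⟩ : ∃ n, m (spanningSets m n) ≠ 0 := by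
      by_contra! hn
      refine hm (Measure.measure_univ_eq_zero.1 ?_)
      rw [← iUnion_spanningSets m]
      exact measure_iUnion_null hn
    have hS := measurableSet_spanningSets m n
    have h := measure_preimage_smul_of_nullMeasurableSet (μ := m.prod P) (G := G)
      (hS.prod hs).nullMeasurableSet g
    have h2 : (fun z : α × β => g • z) ⁻¹' (spanningSets m n ×ˢ s) =
      ((fun x => g • x) ⁻¹' spanningSets m n) ×ˢ ((fun y => g • y) ⁻¹' s) := rfl
    rw [h2, Measure.prod_prod, Measure.prod_prod,
      measure_preimage_smul_of_nullMeasurableSet hS.nullMeasurableSet] at h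
    exact (ENNReal.mul_right_inj hn (measure_spanningSets_lt_top m n).ne).1 h

/-! ### The zero-infinity dichotomy for sections. -/

namespace IsPoissonProcess

variable {X : Type*} [MeasurableSpace X] {μ : Measure X} {P : Measure (Config X)}

/-- Under ergodicity of `X × X^*`, the sections of an invariant relation on `X` are almost all
null or almost all of infinite measure. -/
theorem ae_section_eq_zero_or_top [StandardBorelSpace X] [SigmaFinite μ] {G : Type*} [Group G]
    [MulAction G X] [MeasurableConstSMul G X] [SMulInvariantMeasure G (Config X) P]
    (hP : IsPoissonProcess μ P) (herg : ErgodicSMul G (X × Config X) (μ.prod P))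
    {D : Set (X × X)} (hD : MeasurableSet D)
    (hinv : ∀ g : G, (fun z => g • z) ⁻¹' D =ᵐ[μ.prod μ] D) :
    (∀ᵐ x ∂μ, μ (Prod.mk x ⁻¹' D) = 0) ∨ ∀ᵐ x ∂μ, μ (Prod.mk x ⁻¹' D) = ⊤ := by
  have := hP.isProbabilityMeasure
  let S : ℕ → Set X := spanningSets μ
  have hS : ∀ n, MeasurableSet (S n) := measurableSet_spanningSets μ
  let κ : ℕ → Kernel (X × Config X) X := fun n =>
    (Config.finiteKernel (S n) (hS n)).comap Prod.snd measurable_snd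
  let D' : Set ((X × Config X) × X) := {p | (p.1.1, p.2) ∈ D}
  have hD' : MeasurableSet D' := (measurable_fst.fst.prodMk measurable_snd) hD
  let E : Set (X × Config X) := {a | ∀ n, κ n a (Prod.mk a ⁻¹' D') = 0}
  have hE : MeasurableSet E := by
    have : E = ⋂ n, {a | κ n a (Prod.mk a ⁻¹' D') = 0} := by ext; simp [E]
    rw [this]
    refine .iInter fun n => ?_
    refine Kernel.measurable_kernel_prodMk_left_of_finite hD' (fun a => ?_)
      (measurableSet_singleton 0)
    exact inferInstanceAs (IsFiniteMeasure (Config.finiteKernel (S n) (hS n) a.2))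
  have hsec : ∀ x, MeasurableSet (Prod.mk x ⁻¹' D) := fun x => measurable_prodMk_left hD
  have hfin : ∀ᵐ ω ∂P, ∀ n, ω.count (S n) ≠ ⊤ := ae_all_iff.2 fun n =>
    hP.ae_count_ne_top (hS n) (measure_spanningSets_lt_top μ n).ne
  -- The exceptional set does not depend on `x`, so `g • x` may be substituted later.
  have hEiff : ∀ᵐ ω ∂P, ∀ x, (x, ω) ∈ E ↔ ω.count (Prod.mk x ⁻¹' D) = 0 := by
    filter_upwards [hfin] with ω hω x
    have h1 : ∀ n, κ n (x, ω) (Prod.mk (x, ω) ⁻¹' D') = (ω.count (Prod.mk x ⁻¹' D ∩ S n) : ℝ≥0∞) :=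
      fun n => Config.finiteKernel_apply (hS n) (hω n) (hsec x)
    have h2 : (x, ω) ∈ E ↔ ∀ n, ω.count (Prod.mk x ⁻¹' D ∩ S n) = 0 := by
      simp only [E, mem_ofPred_eq, h1, ENat.toENNReal_eq_zero]
    rw [h2]
    simp only [Config.count, encard_eq_zero]
    constructor
    · intro h
      rw [← inter_univ (Prod.mk x ⁻¹' D), ← iUnion_spanningSets μ, inter_iUnion, inter_iUnion]
      exact iUnion_eq_empty.2 h
    · intro h n
      exact subset_empty_iff.1 (h ▸ inter_subset_inter_right _ inter_subset_left)
  have hconst := herg.aeconst_of_forall_preimage_smul_ae_eq hE fun g => ?_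
  · rw [eventuallyConst_set] at hconst
    rcases hconst with h | h
    · left
      filter_upwards [Measure.ae_ae_of_ae_prod h] with x hx
      refine hP.measure_eq_zero_of_ae_count (hsec x) ?_
      filter_upwards [hx, hEiff] with ω h1 h2 using (h2 x).1 h1
    · right
      filter_upwards [Measure.ae_ae_of_ae_prod h] with x hx
      refine hP.measure_eq_top_of_ae_count_ne (hsec x) ?_
      filter_upwards [hx, hEiff] with ω h1 h2 using fun h3 => h1 ((h2 x).2 h3)
  · have hgE : MeasurableSet ((fun z : X × Config X => g • z) ⁻¹' E) := measurable_const_smul g hE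
    have hgD : MeasurableSet ((fun z : X × X => g • z) ⁻¹' D) := measurable_const_smul g hD
    have hmeas : MeasurableSet {z | z ∈ (fun z : X × Config X => g • z) ⁻¹' E ↔ z ∈ E} :=
      hgE.mem.iff hE.mem |>.setOf
    rw [eventuallyEq_set]
    refine (Measure.ae_prod_iff_ae_ae hmeas).2 ?_
    filter_upwards [Measure.ae_ae_of_ae_prod (eventuallyEq_set.1 (hinv g))] with x hx
    have hEg : ∀ᵐ ω ∂P, ∀ x, (x, g • ω) ∈ E ↔ (g • ω).count (Prod.mk x ⁻¹' D) = 0 :=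
      (measurePreserving_smul g P).quasiMeasurePreserving.ae hEiff
    -- For almost every `x` the two sections differ by a null set, which almost surely contains no
    -- point of `ω`.
    have hN : MeasurableSet {y | ¬ ((x, y) ∈ (fun z : X × X => g • z) ⁻¹' D ↔ (x, y) ∈ D)} :=
      ((measurable_prodMk_left hgD).mem.iff (hsec x).mem).not.setOf
    filter_upwards [hEg, hEiff, hP.ae_count_eq_zero hN hx] with ω h1 h2 h3
    have h4 : (x, ω) ∈ (fun z : X × Config X => g • z) ⁻¹' E ↔
        (g • ω).count (Prod.mk (g • x) ⁻¹' D) = 0 := h1 (g • x)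
    rw [h4, h2 x, Config.count_smul]
    simp only [Config.count, encard_eq_zero, eq_empty_iff_forall_notMem] at h3 ⊢
    refine forall_congr' fun y => ?_
    have h5 := h3 y
    simp only [mem_inter_iff, mem_ofPred_eq, mem_preimage, Prod.smul_mk] at h5 ⊢
    tauto

end IsPoissonProcess

/-! ### The intensity of a matching. -/

/-- The intensity on `X × X` of the random set of matched pairs. -/
noncomputable def matchingIntensity {X : Type*} [MeasurableSpace X] (P : Measure (Config X))
    (Ψ : Config X × Config X → Config (X × X)) : Measure (X × X) :=
  (P.prod P).bind fun ω => (Ψ ω).toMeasure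

namespace IsPoissonMatching

variable {X : Type*} [MeasurableSpace X] {μ : Measure X} {P : Measure (Config X)}
  {Ψ : Config X × Config X → Config (X × X)}

theorem aemeasurable_count (hΨ : IsPoissonMatching P Ψ) {C : Set (X × X)}
    (hC : MeasurableSet C) :
    AEMeasurable (fun ω => ((Ψ ω).count C : ℝ≥0∞)) (P.prod P) :=
  (Config.measurable_toENNReal_count hC).comp_aemeasurable hΨ.aemeasurable

variable [StandardBorelSpace X]

theorem matchingIntensity_apply (hΨ : IsPoissonMatching P Ψ) {C : Set (X × X)}
    (hC : MeasurableSet C) :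
    matchingIntensity P Ψ C = ∫⁻ ω, ((Ψ ω).count C : ℝ≥0∞) ∂(P.prod P) := by
  have hm : AEMeasurable (fun ω => (Ψ ω).toMeasure) (P.prod P) :=
    Config.measurable_toMeasure.comp_aemeasurable hΨ.aemeasurable
  rw [matchingIntensity, Measure.bind_apply hC hm]
  simp only [Config.toMeasure_apply _ hC]

theorem matchingIntensity_prod_univ (hΨ : IsPoissonMatching P Ψ) (hP : IsPoissonProcess μ P)
    {B : Set X} (hB : MeasurableSet B) : matchingIntensity P Ψ (B ×ˢ univ) = μ B := by
  have := hP.isProbabilityMeasure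
  have hC : MeasurableSet (B ×ˢ (univ : Set X)) := hB.prod .univ
  rw [hΨ.matchingIntensity_apply hC, lintegral_prod _ (hΨ.aemeasurable_count hC),
    ← hP.lintegral_count hB]
  refine lintegral_congr_ae ?_
  filter_upwards [hΨ.count_fst B hB] with ω₁ h
  rw [lintegral_congr_ae (g := fun _ => (ω₁.count B : ℝ≥0∞)) (h.mono fun ω₂ h2 => by rw [h2])]
  simp

/-- For values in `ℕ∞` the minimum is at most the product, and the expectation of the product
factors by independence of the two realizations. -/
theorem matchingIntensity_le (hΨ : IsPoissonMatching P Ψ) (hP : IsPoissonProcess μ P)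
    [SigmaFinite μ] : matchingIntensity P Ψ ≤ μ.prod μ := by
  have := hP.isProbabilityMeasure
  refine measure_le_prod_of_rectangles fun B₁ B₂ h₁ h₂ => ?_
  rw [hΨ.matchingIntensity_apply (h₁.prod h₂), lintegral_prod _ (hΨ.aemeasurable_count (h₁.prod h₂))]
  calc ∫⁻ ω₁, ∫⁻ ω₂, ((Ψ (ω₁, ω₂)).count (B₁ ×ˢ B₂) : ℝ≥0∞) ∂P ∂P
      ≤ ∫⁻ ω₁, ∫⁻ ω₂, (ω₁.count B₁ : ℝ≥0∞) * (ω₂.count B₂ : ℝ≥0∞) ∂P ∂P := by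
        refine lintegral_mono_ae ((hΨ.count_prod_le B₁ B₂ h₁ h₂).mono fun ω₁ h => ?_)
        refine lintegral_mono_ae (h.mono fun ω₂ h' => ?_)
        rw [← ENat.toENNReal_mul, ENat.toENNReal_le]
        refine h'.trans ?_
        by_cases h0 : ω₂.count B₂ = 0
        · simp [h0]
        · exact (min_le_left _ _).trans (le_mul_of_one_le_right' (Order.one_le_iff_ne_zero.2 h0))
    _ = μ B₁ * μ B₂ := by
        simp_rw [lintegral_const_mul _ (Config.measurable_toENNReal_count h₂)]
        rw [lintegral_mul_const _ (Config.measurable_toENNReal_count h₁),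
          hP.lintegral_count h₁, hP.lintegral_count h₂]

theorem measurePreserving_matchingIntensity {G : Type*} [Group G] [MulAction G X]
    [MeasurableConstSMul G X] [SFinite P] [SMulInvariantMeasure G (Config X) P]
    (hΨ : IsPoissonMatching P Ψ) (hE : IsEquivariantMatching G P Ψ) (g : G) :
    MeasurePreserving (fun z : X × X => g • z) (matchingIntensity P Ψ)
      (matchingIntensity P Ψ) := by
  have hg : Measurable fun z : X × X => g • z := measurable_const_smul g
  refine ⟨hg, Measure.ext fun C hC => ?_⟩
  have hPP : MeasurePreserving (fun ω : Config X × Config X => (g • ω.1, g • ω.2))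
      (P.prod P) (P.prod P) := (measurePreserving_smul g P).prod (measurePreserving_smul g P)
  rw [Measure.map_apply hg hC, hΨ.matchingIntensity_apply (hg hC), hΨ.matchingIntensity_apply hC]
  have hm := hΨ.aemeasurable_count hC
  conv_rhs => rw [← hPP.map_eq]
  rw [lintegral_map' (by rwa [hPP.map_eq]) hPP.measurable.aemeasurable]
  refine lintegral_congr_ae ((hE g).mono fun ω hω => ?_)
  simp only [hω, Config.count_smul]

end IsPoissonMatching

/-! ### Vanishing of the density and the contradiction. -/

theorem mainTheorem8 {X : Type*} [MeasurableSpace X] [StandardBorelSpace X]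
    (μ : Measure X) [SigmaFinite μ] [NullSingletonClass μ] (hμ : μ ≠ 0)
    {G : Type*} [Group G] [MulAction G X] [MeasurableConstSMul G X] [SMulInvariantMeasure G X μ]
    -- `P = μ^*`, the law of the Poisson process on `X` with intensity `μ`
    (P : Measure (Config X)) (hP : IsPoissonProcess μ P)
    -- `Q = (μ × μ^*)^*`, the law of the Poisson process on `X × X^*` with intensity `μ × μ^*`
    (Q : Measure (Config (X × Config X))) (hQ : IsPoissonProcess (μ.prod P) Q)
    -- with `S = T × T_*` the action on `X × X^*`, the action `S × S_*` is ergodic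
    (hS : ErgodicSMul G ((X × Config X) × Config (X × Config X)) ((μ.prod P).prod Q)) :
    ¬ ∃ Ψ : Config X × Config X → Config (X × X),
      IsPoissonMatching P Ψ ∧ IsEquivariantMatching G P Ψ := by
  rintro ⟨Ψ, hΨ, hE⟩
  have := hP.isProbabilityMeasure
  have := hQ.isProbabilityMeasure
  have herg : ErgodicSMul G (X × Config X) (μ.prod P) := hS.fst_of_prod
  -- Invariance of `μ.prod P` is part of ergodicity, so no uniqueness of the Poisson law is needed.
  have hPinv : SMulInvariantMeasure G (Config X) P :=
    SMulInvariantMeasure.snd_of_prod (m := μ) hμ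
  set M := matchingIntensity P Ψ
  have hM_le : M ≤ μ.prod μ := hΨ.matchingIntensity_le hP
  have hM_ac : M ≪ μ.prod μ := Measure.absolutelyContinuous_of_le hM_le
  have : SigmaFinite M := Measure.sigmaFinite_of_le _ hM_le
  have hf_meas : Measurable (M.rnDeriv (μ.prod μ)) := Measure.measurable_rnDeriv _ _
  have hf_inv : ∀ g : G, ∀ᵐ z ∂(μ.prod μ),
      M.rnDeriv (μ.prod μ) (g • z) = M.rnDeriv (μ.prod μ) z := fun g =>
    rnDeriv_comp_ae_eq_of_measurePreserving hM_ac
      ((MeasurableEquiv.smul g).prodCongr (MeasurableEquiv.smul g))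
      (hΨ.measurePreserving_matchingIntensity hE g)
      ((measurePreserving_smul g μ).prod (measurePreserving_smul g μ))
  -- Finiteness of `μ B` will exclude infinite sections; positivity gives the final contradiction.
  obtain ⟨n, hn⟩ : ∃ n, μ (spanningSets μ n) ≠ 0 := by
    by_contra! hn
    refine hμ (Measure.measure_univ_eq_zero.1 ?_)
    rw [← iUnion_spanningSets μ]
    exact measure_iUnion_null hn
  set B := spanningSets μ n
  have hB : MeasurableSet B := measurableSet_spanningSets μ n
  have hB_top : μ B ≠ ⊤ := (measure_spanningSets_lt_top μ n).ne
  have hMB : M (B ×ˢ univ) = μ B := hΨ.matchingIntensity_prod_univ hP hB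
  have hnull : ∀ k : ℕ, ∀ᵐ z ∂(μ.prod μ), M.rnDeriv (μ.prod μ) z ≤ ((k : ℝ≥0∞) + 1)⁻¹ := by
    intro k
    have hc : ((k : ℝ≥0∞) + 1)⁻¹ ≠ 0 := by simp
    set D : Set (X × X) := {z | ((k : ℝ≥0∞) + 1)⁻¹ < M.rnDeriv (μ.prod μ) z}
    have hD : MeasurableSet D := measurableSet_lt measurable_const hf_meas
    have hD_inv : ∀ g : G, (fun z => g • z) ⁻¹' D =ᵐ[μ.prod μ] D := fun g => by
      refine eventuallyEq_set.2 ((hf_inv g).mono fun z hz => ?_)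
      simp only [D, mem_preimage, mem_ofPred_eq, hz]
    rcases hP.ae_section_eq_zero_or_top herg hD hD_inv with h | h
    · have : ∀ᵐ z ∂(μ.prod μ), z ∉ D := by
        simpa [ae_iff] using Measure.measure_prod_null_of_ae_null hD h
      exact this.mono fun z hz => not_lt.1 hz
    · exfalso
      have h1 : (μ.prod μ) (D ∩ B ×ˢ univ) = ⊤ := by
        rw [Measure.prod_apply (hD.inter (hB.prod .univ)), ← top_le_iff]
        calc ⊤ = ∫⁻ x in B, ⊤ ∂μ := by simp [ENNReal.top_mul hn]
          _ ≤ ∫⁻ x in B, μ (Prod.mk x ⁻¹' (D ∩ B ×ˢ univ)) ∂μ := by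
            refine lintegral_mono_ae ?_
            filter_upwards [ae_restrict_mem hB, ae_restrict_of_ae h] with x hx hx'
            rw [← hx']
            exact measure_mono fun y hy => ⟨hy, hx, trivial⟩
          _ ≤ _ := setLIntegral_le_lintegral _ _
      -- Markov's inequality for the density over `B ×ˢ univ`, whose integral there is `μ B`.
      have h2 : ((k : ℝ≥0∞) + 1)⁻¹ * (μ.prod μ) (D ∩ B ×ˢ univ) ≤ μ B := by
        calc ((k : ℝ≥0∞) + 1)⁻¹ * (μ.prod μ) (D ∩ B ×ˢ univ)
            = ∫⁻ z in D ∩ B ×ˢ univ, ((k : ℝ≥0∞) + 1)⁻¹ ∂(μ.prod μ) := by simp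
          _ ≤ ∫⁻ z in D ∩ B ×ˢ univ, M.rnDeriv (μ.prod μ) z ∂(μ.prod μ) :=
            setLIntegral_mono' (hD.inter (hB.prod .univ)) fun z hz => hz.1.le
          _ = M (D ∩ B ×ˢ univ) := Measure.setLIntegral_rnDeriv hM_ac _
          _ ≤ M (B ×ˢ univ) := measure_mono inter_subset_right
          _ = μ B := hMB
      rw [h1, ENNReal.mul_top hc] at h2
      exact hB_top (top_le_iff.1 h2)
  have hf_zero : ∀ᵐ z ∂(μ.prod μ), M.rnDeriv (μ.prod μ) z = 0 := by
    filter_upwards [ae_all_iff.2 hnull] with z hz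
    by_contra h0
    obtain ⟨k, hk⟩ := ENNReal.exists_inv_nat_lt h0
    refine absurd ((hz k).trans (ENNReal.inv_le_inv.2 le_self_add)) (not_le.2 hk)
  refine hn ?_
  rw [← hMB, ← Measure.setLIntegral_rnDeriv hM_ac, lintegral_congr_ae (ae_restrict_of_ae hf_zero)]
  simp
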